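/- For an integer $m \ge 1$, the search problem mon-crossing$(m)$ is the following. Alice holds integers $0 = x_0 \le x_1 \le \cdots \le x_m = m$ and Bob holds integers $m = y_0 \ge y_1 \ge \cdots \ge y_m = 0$. They have to find an index $1 \le i \le m$ such that $x_{i-1} \le y_{i-1}$ and $x_i \ge y_i$. A protocol with $r$ rounds of $t$ bits is a two-party communication protocol in which, in each of the $r$ rounds, each player sends a (possibly empty) message of at most $t$ bits that depends on the player's input, on the player's coins and on the messages of the earlier rounds; the output is determined by the messages sent (and by the public coins). A deterministic protocol uses no coins and solves the problem if its output is a solution on every input. A randomized protocol may use public coins and independent private coins of each player, with arbitrary distributions; it solves the problem with error $\varepsilon$ if on every input its output is a solution except with probability at most $\varepsilon$. All logarithms are to base $2$. **Theorem.** Any deterministic protocol, and any randomized protocol with constant error, that solves mon-crossing$(m)$ using rounds of $t$ bits each, where $\log m \le t \le m$, needs $\Omega(\log m/\log t)$ rounds. Precisely: 1. There is a constant $c > 0$ such that for all integers $m, t$ with $t \ge 2$ and $\log m \le t \le m$, every deterministic protocol that solves mon-crossing$(m)$ with $r$ rounds of $t$ bits satisfies $r \ge c \cdot \frac{\log m}{\log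 t}$. 2. For every $0 \le \varepsilon < 1$ there is a constant $c > 0$, depending only on $\varepsilon$, such that for all integers $m, t$ with $t \ge 2$, $\log m \le t \le m$ and $(1-\varepsilon) m > 1$, every randomized protocol that solves mon-crossing$(m)$ with error $\varepsilon$ and with $r$ rounds of $t$ bits satisfies $r \ge c \cdot \frac{\log m}{\log t}$. (If $(1-\varepsilon)m \le 1$, outputting a uniformly random index already has error at most $\varepsilon$ with no communication. For $\varepsilon = 1/3$ the condition is $m \ge 2$.) -/

import Mathlib

open MeasureTheory

/-- A message of one player in one round: a string of at most `t` bits (possibly empty). -/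
abbrev Message (t : ℕ) : Type := {w : List Bool // w.length ≤ t}

/-- A transcript: for every round so far, in order, the message of Alice and the message of Bob. -/
abbrev Transcript (t : ℕ) : Type := List (Message t × Message t)

/-- A deterministic two-party communication protocol with `r` rounds of at most `t` bits each.
Alice holds an element of `X`, Bob an element of `Y`. In each round each player sends a message
that depends on the own input and on the transcript of the previous rounds. Either message may be
empty, so protocols in which only one player speaks in a round are included. The output is a
function of the final transcript (the label of the leaf that is reached). -/
structure Protocol (X Y Z : Type*) (t r : ℕ) where
  alice : X → Transcript t → Message t
  bob : Y → Transcript t → Message t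
  out : Transcript t → Z

namespace Protocol

variable {X Y Z : Type*} {t r : ℕ}

/-- The transcript after the first `n` rounds on the input `(x, y)`. -/
def transcript (P : Protocol X Y Z t r) (x : X) (y : Y) : ℕ → Transcript t
  | 0 => []
  | n + 1 =>
      transcript P x y n ++ [(P.alice x (transcript P x y n), P.bob y (transcript P x y n))]

/-- The output on the input `(x, y)`: the label of the transcript after all `r` rounds. -/
def output (P : Protocol X Y Z t r) (x : X) (y : Y) : Z :=
  P.out (P.transcript x y r)

/-- The protocol solves the search problem `S`: on every input the output is a solution. -/
def Solves (P : Protocol X Y Z t r) (S : X → Y → Z → Prop) : Prop :=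
  ∀ x y, S x y (P.output x y)

end Protocol

/-- A randomized protocol with `r` rounds of at most `t` bits each, with public coins in `R`
(seen by both players and by the output), private coins in `A` of Alice and private coins in `B`
of Bob. -/
structure RandomizedProtocol (R A B X Y Z : Type*) (t r : ℕ) where
  alice : R → A → X → Transcript t → Message t
  bob : R → B → Y → Transcript t → Message t
  out : R → Transcript t → Z

namespace RandomizedProtocol

variable {R A B X Y Z : Type*} {t r : ℕ}

/-- The deterministic protocol that is followed once all coins are tossed. -/
def fixCoins (P : RandomizedProtocol R A B X Y Z t r) (ρ : R) (a : A) (b : B) :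
    Protocol X Y Z t r where
  alice := P.alice ρ a
  bob := P.bob ρ b
  out := P.out ρ

/-- The protocol solves the search problem `S` with probability of error at most `ε`, when the
public coins, Alice's coins and Bob's coins are independent with laws `μ`, `α` and `β`: on every
input, the output fails to be a solution with probability at most `ε`. (The measure of a set that
is not measurable is its outer measure.) -/
def SolvesWithError [MeasurableSpace R] [MeasurableSpace A] [MeasurableSpace B]
    (P : RandomizedProtocol R A B X Y Z t r) (μ : Measure R) (α : Measure A) (β : Measure B)
    (S : X → Y → Z → Prop) (ε : ℝ) : Prop :=
  ∀ x y, (μ.prod (α.prod β)) {ω | ¬ S x y ((P.fixCoins ω.1 ω.2.1 ω.2.2).output x y)}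
    ≤ ENNReal.ofReal ε

end RandomizedProtocol

/-- Alice's inputs in the monotone crossing problem: `0 = x₀ ≤ x₁ ≤ ⋯ ≤ xₘ = m`. -/
def MonCrossingAlice (m : ℕ) : Type :=
  {x : Fin (m + 1) → ℕ // x 0 = 0 ∧ Monotone x ∧ x (Fin.last m) = m}

/-- Bob's inputs in the monotone crossing problem: `m = y₀ ≥ y₁ ≥ ⋯ ≥ yₘ = 0`. -/
def MonCrossingBob (m : ℕ) : Type :=
  {y : Fin (m + 1) → ℕ // y 0 = m ∧ Antitone y ∧ y (Fin.last m) = 0}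

/-- The monotone crossing problem: find `1 ≤ i ≤ m` with `xᵢ₋₁ ≤ yᵢ₋₁` and `xᵢ ≥ yᵢ`.
The element `j` of `Fin m` stands for the index `i = j + 1`. -/
def MonCrossing (m : ℕ) (x : MonCrossingAlice m) (y : MonCrossingBob m) (j : Fin m) : Prop :=
  x.1 j.castSucc ≤ y.1 j.castSucc ∧ x.1 j.succ ≥ y.1 j.succ

/-! Pointer jumping embeds in monotone crossing. In a complete `k`-ary tree whose levels are owned
alternately by the players, the pointers lead to one leaf. Each player's half of the input becomes a
staircase, and the two staircases cross at a single index, which reveals that leaf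
(`treePath_cross`, `MonCrossing.eq_treeLeaf`).

Split `r` rounds into `2 * r` alternating messages, the first sent by the player who does not own
the root. This message is chosen without knowing the root pointer, so its O(`t`) bits of information
are spread over `k` subtrees and say little about the one that matters. Dropping it leaves the
problem on a subtree with the roles exchanged, at a small loss of success (`SuccessBound.succ`).
When no message is left, a constant answer must guess a pointer. The induction closes because inputs
need not be uniform, only product weights dominated by uniform ones, a property restored by trimming
after conditioning on a message (`Dominated.exists_trim`).

For `k = t ^ 3` the success is at most `(8 * r + 1) / t`. If `r` is small compared with log `m` /
log `t`, a tree of depth `2 * r + 1` fits into `m`, and log `m` ≤ `t` pushes the success below `1 -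
ε`. Coins are fixed by averaging over the finite family of hard inputs. -/

/-! ### Averages over finite types. -/

/-- The average of a real function on a finite type. -/
noncomputable def mean {B : Type*} [Fintype B] (h : B → ℝ) : ℝ :=
  (Fintype.card B : ℝ)⁻¹ * ∑ b, h b

section Mean

variable {B : Type*} [Fintype B]

lemma mean_add (f g : B → ℝ) : mean (fun b => f b + g b) = mean f + mean g := by
  simp only [mean, Finset.sum_add_distrib, mul_add]

lemma mean_const_mul (a : ℝ) (f : B → ℝ) : mean (fun b => a * f b) = a * mean f := by
  simp only [mean, ← Finset.mul_sum]; ring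

lemma mean_const [Nonempty B] (a : ℝ) : mean (fun _ : B => a) = a := by
  have : (Fintype.card B : ℝ) ≠ 0 := by exact_mod_cast Fintype.card_ne_zero
  simp [mean, this]

lemma mean_sum {T : Type*} [Fintype T] (f : T → B → ℝ) :
    mean (fun b => ∑ m, f m b) = ∑ m, mean (f m) := by
  simp only [mean, ← Finset.mul_sum]
  rw [Finset.sum_comm]

lemma mean_mono {f g : B → ℝ} (h : ∀ b, f b ≤ g b) : mean f ≤ mean g :=
  mul_le_mul_of_nonneg_left (Finset.sum_le_sum fun b _ => h b) (by positivity)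

lemma mean_nonneg {f : B → ℝ} (h : ∀ b, 0 ≤ f b) : 0 ≤ mean f :=
  mul_nonneg (by positivity) (Finset.sum_nonneg fun b _ => h b)

lemma mean_pi_prod {k : ℕ} (F : Fin k → B → ℝ) :
    mean (fun b : Fin k → B => ∏ i, F i (b i)) = ∏ i, mean (F i) := by
  classical
  simp only [mean, Finset.prod_mul_distrib, Finset.prod_univ_sum, Fintype.piFinset_univ]
  simp

lemma mean_pi_apply [Nonempty B] {k : ℕ} (c : Fin k) (h : B → ℝ) :
    mean (fun b : Fin k → B => h (b c)) = mean h := by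
  have key := mean_pi_prod (fun (i : Fin k) (b : B) => if i = c then h b else 1)
  have e1 : (fun b : Fin k → B => ∏ i, (if i = c then h (b i) else 1)) = fun b => h (b c) := by
    funext b; simp
  have e2 : ∀ i : Fin k, mean (fun b : B => if i = c then h b else 1)
      = if i = c then mean h else 1 := by
    intro i
    split_ifs
    · rfl
    · exact mean_const 1
  rw [e1] at key
  rw [key]
  simp [e2]

lemma mean_prod_fst_eq {k : ℕ} [Nonempty B] (c : Fin k) (h : B → ℝ) :
    mean (fun q : Fin k × B => if q.1 = c then h q.2 else 0) = (k : ℝ)⁻¹ * mean h := by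
  simp only [mean, Fintype.sum_prod_type]
  rw [Finset.sum_eq_single c]
  · simp; ring
  · intro i _ hi; simp [hi]
  · simp

end Mean

/-! ### Dominated weights and the information carried by one message. -/

/-- The push-forward under `β` of the weight `w` is at most `a` times the uniform distribution. -/
def Dominated {V B : Type*} [Fintype V] [Fintype B] (a : ℝ) (w : V → ℝ) (β : V → B) : Prop :=
  ∀ h : B → ℝ, (∀ b, 0 ≤ h b) → ∑ v, w v * h (β v) ≤ a * mean h

lemma Dominated.sum_le {V B : Type*} [Fintype V] [Fintype B] [Nonempty B] {a : ℝ} {w : V → ℝ}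
    {β : V → B} (h : Dominated a w β) : ∑ v, w v ≤ a := by
  simpa [mean_const] using h (fun _ => 1) (fun _ => zero_le_one)

/-- For |s| ≤ 1 one has exp s ≤ 1 + s + s², and the linear term averages to zero. -/
lemma mean_exp_centered_le {B : Type*} [Fintype B] [Nonempty B] (f : B → ℝ)
    (h0 : ∀ b, 0 ≤ f b) (h1 : ∀ b, f b ≤ 1) {l : ℝ} (hl0 : 0 ≤ l) (hl1 : l ≤ 1) :
    mean (fun b => Real.exp (l * (f b - mean f))) ≤ Real.exp (l ^ 2) := by
  have hm0 : 0 ≤ mean f := mean_nonneg h0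
  have hm1 : mean f ≤ 1 := by simpa [mean_const] using mean_mono (g := fun _ => 1) h1
  have key : ∀ b, Real.exp (l * (f b - mean f)) ≤ (1 - l * mean f + l ^ 2) + l * f b := by
    intro b
    have habs : |f b - mean f| ≤ 1 := abs_le.2 ⟨by linarith [h0 b], by linarith [h1 b]⟩
    have hs : |l * (f b - mean f)| ≤ l := by
      rw [abs_mul, abs_of_nonneg hl0]
      exact mul_le_of_le_one_right hl0 habs
    have h2 := (abs_le.1 (Real.abs_exp_sub_one_sub_id_le (hs.trans hl1))).2
    have h3 : (l * (f b - mean f)) ^ 2 ≤ l ^ 2 := by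
      rw [← sq_abs]; exact pow_le_pow_left₀ (abs_nonneg _) hs 2
    linarith
  calc mean (fun b => Real.exp (l * (f b - mean f)))
      ≤ mean (fun b => (1 - l * mean f + l ^ 2) + l * f b) := mean_mono key
    _ = l ^ 2 + 1 := by rw [mean_add, mean_const, mean_const_mul]; ring
    _ ≤ Real.exp (l ^ 2) := Real.add_one_le_exp _

lemma mean_exp_sum_centered_le {B : Type*} [Fintype B] [Nonempty B] {k : ℕ} (f : Fin k → B → ℝ)
    (h0 : ∀ c b, 0 ≤ f c b) (h1 : ∀ c b, f c b ≤ 1) {l : ℝ} (hl0 : 0 ≤ l) (hl1 : l ≤ 1) :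
    mean (fun b : Fin k → B => Real.exp (l * ∑ c, (f c (b c) - mean (f c))))
      ≤ Real.exp (k * l ^ 2) := by
  simp only [Finset.mul_sum, Real.exp_sum]
  rw [mean_pi_prod (fun c b => Real.exp (l * (f c b - mean (f c))))]
  calc ∏ c, mean (fun b => Real.exp (l * (f c b - mean (f c))))
      ≤ ∏ _c : Fin k, Real.exp (l ^ 2) := by
        refine Finset.prod_le_prod (fun c _ => mean_nonneg fun b => (Real.exp_pos _).le)
          fun c _ => mean_exp_centered_le (f c) (h0 c) (h1 c) hl0 hl1
    _ = Real.exp (k * l ^ 2) := by simp [← Real.exp_nat_mul]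

/-- The maximal inequality for sums of independent centered variables, in the form that is needed
to bound the information carried by a message `M`. -/
lemma Dominated.mul_sum_centered_le {V B T : Type*} [Fintype V] [Fintype B] [Nonempty B]
    [Fintype T] [Nonempty T] {k : ℕ} {a : ℝ} (ha : 0 ≤ a) {w : V → ℝ} (hw : ∀ v, 0 ≤ w v)
    {β : V → Fin k → B} (hβ : Dominated a w β) (M : V → T) (f : T → Fin k → B → ℝ)
    (h0 : ∀ m c b, 0 ≤ f m c b) (h1 : ∀ m c b, f m c b ≤ 1)
    {l : ℝ} (hl0 : 0 ≤ l) (hl1 : l ≤ 1) :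
    l * ∑ v, w v * ∑ c, (f (M v) c (β v c) - mean (f (M v) c))
      ≤ a * (Real.log (Fintype.card T) + k * l ^ 2 + 1) := by
  -- exp `A` bounds the sum over all messages of the exponential moments: a union bound, needed
  -- because the message selects the test functions.
  set A : ℝ := Real.log (Fintype.card T) + k * l ^ 2 with hA
  have hT : (1 : ℝ) ≤ Fintype.card T := by exact_mod_cast Fintype.card_pos
  have hA0 : 0 ≤ A := add_nonneg (Real.log_nonneg hT) (by positivity)
  let X : T → (Fin k → B) → ℝ := fun m b => l * ∑ c, (f m c (b c) - mean (f m c))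
  -- From x ≤ `A` + exp (x - `A`): a majorant of all `X m` at once, nonnegative so that domination
  -- applies to it.
  let H : (Fin k → B) → ℝ := fun b => A + Real.exp (-A) * ∑ m, Real.exp (X m b)
  have hX : ∀ m b, X m b ≤ H b := by
    intro m b
    have e1 : X m b - A + 1 ≤ Real.exp (X m b - A) := Real.add_one_le_exp _
    have e2 : Real.exp (X m b) ≤ ∑ m, Real.exp (X m b) :=
      Finset.single_le_sum (f := fun m => Real.exp (X m b))
        (fun i _ => (Real.exp_pos _).le) (Finset.mem_univ m)
    have e3 : Real.exp (X m b - A) = Real.exp (-A) * Real.exp (X m b) := by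
      rw [← Real.exp_add]; ring_nf
    have e4 := mul_le_mul_of_nonneg_left e2 (Real.exp_pos (-A)).le
    simp only [H]
    linarith
  have hmean : mean H ≤ A + 1 := by
    have : mean H = A + Real.exp (-A) * ∑ m, mean (fun b => Real.exp (X m b)) := by
      simp only [H]
      rw [mean_add, mean_const, mean_const_mul, mean_sum]
    rw [this]
    have e : ∑ m, mean (fun b => Real.exp (X m b)) ≤ Real.exp A := by
      calc ∑ m, mean (fun b => Real.exp (X m b)) ≤ ∑ _m : T, Real.exp (k * l ^ 2) :=
            Finset.sum_le_sum fun m _ =>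
              mean_exp_sum_centered_le (f m) (h0 m) (h1 m) hl0 hl1
        _ = Real.exp A := by
            rw [hA, Real.exp_add, Real.exp_log (by linarith)]; simp
    have e' := mul_le_mul_of_nonneg_left e (Real.exp_pos (-A)).le
    rw [← Real.exp_add, neg_add_cancel, Real.exp_zero] at e'
    linarith
  calc l * ∑ v, w v * ∑ c, (f (M v) c (β v c) - mean (f (M v) c))
      = ∑ v, w v * X (M v) (β v) := by
        rw [Finset.mul_sum]; exact Finset.sum_congr rfl fun v _ => by simp only [X]; ring
    _ ≤ ∑ v, w v * H (β v) :=
        Finset.sum_le_sum fun v _ => mul_le_mul_of_nonneg_left (hX _ _) (hw v)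
    _ ≤ a * mean H := hβ H fun b => by positivity
    _ ≤ a * (A + 1) := mul_le_mul_of_nonneg_left hmean ha

/-- A weight can be trimmed so that it is dominated by the uniform distribution of the given mass;
the mass that is lost is the excess on a set of values. -/
lemma exists_dominated_le {V B : Type*} [Fintype V] [Fintype B] [Nonempty B] (w : V → ℝ)
    (hw : ∀ v, 0 ≤ w v) (β : V → B) {a : ℝ} (ha : 0 ≤ a) :
    ∃ (w' : V → ℝ) (f : B → ℝ), (∀ v, 0 ≤ w' v) ∧ (∀ v, w' v ≤ w v) ∧ Dominated a w' β ∧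
      (∀ b, 0 ≤ f b) ∧ (∀ b, f b ≤ 1) ∧
      ∑ v, (w v - w' v) = (∑ v, w v * f (β v)) - a * mean f := by
  classical
  have hB : (0 : ℝ) < Fintype.card B := by exact_mod_cast Fintype.card_pos
  -- `τ` caps the mass of a point, `p` is the push-forward, and `ρ` scales overloaded points down to
  -- the cap. The test function `f` will be the indicator of the overloaded points.
  set τ : ℝ := a * (Fintype.card B : ℝ)⁻¹ with hτ
  have hτ0 : 0 ≤ τ := by positivity
  let p : B → ℝ := fun b => ∑ v, if β v = b then w v else 0
  have hp : ∀ b, 0 ≤ p b := fun b => Finset.sum_nonneg fun v _ => by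
    split_ifs
    · exact hw v
    · exact le_rfl
  let ρ : B → ℝ := fun b => if τ < p b then τ / p b else 1
  have hρ0 : ∀ b, 0 ≤ ρ b := by
    intro b; simp only [ρ]; split_ifs
    · exact div_nonneg hτ0 (hp b)
    · exact zero_le_one
  have hρ1 : ∀ b, ρ b ≤ 1 := by
    intro b; simp only [ρ]; split_ifs with h
    · exact div_le_one_of_le₀ h.le (hp b)
    · exact le_rfl
  have hρp : ∀ b, p b * ρ b ≤ τ := by
    intro b; simp only [ρ]; split_ifs with h
    · rw [mul_div_cancel₀ _ (by linarith : p b ≠ 0)]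
    · simpa using h
  have push : ∀ h : B → ℝ, ∑ v, w v * h (β v) = ∑ b, p b * h b := by
    intro h
    simp only [p, Finset.sum_mul]
    rw [Finset.sum_comm]
    refine Finset.sum_congr rfl fun v _ => ?_
    simp
  refine ⟨fun v => w v * ρ (β v), fun b => if τ < p b then 1 else 0,
    fun v => mul_nonneg (hw v) (hρ0 _), fun v => mul_le_of_le_one_right (hw v) (hρ1 _), ?_,
    fun b => by positivity, fun b => ?_, ?_⟩
  · intro h hh
    simp only [mul_assoc]
    rw [push (fun b => ρ b * h b)]
    calc ∑ b, p b * (ρ b * h b) ≤ ∑ b, τ * h b := Finset.sum_le_sum fun b _ => by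
          rw [← mul_assoc]; exact mul_le_mul_of_nonneg_right (hρp b) (hh b)
      _ = a * mean h := by rw [← Finset.mul_sum, hτ, mean]; ring
  · dsimp only
    split_ifs <;> norm_num
  · have e1 : ∑ v, (w v - w v * ρ (β v)) = ∑ b, p b * (1 - ρ b) := by
      rw [← push]; exact Finset.sum_congr rfl fun v _ => by ring
    rw [e1, push (fun b => if τ < p b then 1 else 0), mean, ← mul_assoc, ← hτ, Finset.mul_sum, ← Finset.sum_sub_distrib]
    refine Finset.sum_congr rfl fun b _ => ?_
    simp only [ρ]
    split_ifs with h
    · rw [mul_sub, mul_div_cancel₀ _ (by linarith : p b ≠ 0), mul_one, mul_one]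
    · simp

/-- Elimination of a message: conditioned on the message, and for an average coordinate, the input
is close to uniform. -/
lemma Dominated.exists_trim {V B T : Type*} [Fintype V] [Fintype B] [Nonempty B]
    [Fintype T] [Nonempty T] [DecidableEq T] {k : ℕ} {a : ℝ} (ha : 0 ≤ a) {w : V → ℝ}
    (hw : ∀ v, 0 ≤ w v) {β : V → Fin k → B} (hβ : Dominated a w β) (M : V → T)
    {l : ℝ} (hl0 : 0 ≤ l) (hl1 : l ≤ 1) :
    ∃ w' : Fin k → T → V → ℝ, (∀ c m v, 0 ≤ w' c m v) ∧
      (∀ c m v, w' c m v ≤ if M v = m then w v else 0) ∧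
      (∀ c m, Dominated (∑ v, if M v = m then w v else 0) (w' c m) (fun v => β v c)) ∧
      l * ∑ c, ∑ m, ∑ v, ((if M v = m then w v else 0) - w' c m v)
        ≤ a * (Real.log (Fintype.card T) + k * l ^ 2 + 1) := by
  have hwm : ∀ m v, 0 ≤ if M v = m then w v else 0 := by
    intro m v; split_ifs
    · exact hw v
    · exact le_rfl
  -- The cap is the mass of the message itself, so the trimmed mass is the distance of the
  -- conditional law from uniform.
  have key := fun c m => exists_dominated_le (fun v => if M v = m then w v else 0) (hwm m)
    (fun v => β v c) (a := ∑ v, if M v = m then w v else 0)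
    (Finset.sum_nonneg fun v _ => hwm m v)
  choose w' f h1 h2 h3 h4 h5 h6 using key
  refine ⟨w', h1, h2, h3, ?_⟩
  have := hβ.mul_sum_centered_le ha hw M (fun m c => f c m) (fun m c => h4 c m)
    (fun m c => h5 c m) hl0 hl1
  refine le_trans (le_of_eq ?_) this
  congr 1
  have pick : ∀ c v, ∑ m, (if M v = m then w v else 0) * (f c m (β v c) - mean (f c m))
      = w v * (f c (M v) (β v c) - mean (f c (M v))) := by
    intro c v
    rw [Finset.sum_eq_single (M v)]
    · simp
    · intro m _ hm; simp [hm.symm]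
    · simp
  calc ∑ c, ∑ m, ∑ v, ((if M v = m then w v else 0) - w' c m v)
      = ∑ c, ∑ m, ∑ v, (if M v = m then w v else 0) * (f c m (β v c) - mean (f c m)) := by
        refine Finset.sum_congr rfl fun c _ => Finset.sum_congr rfl fun m _ => ?_
        rw [h6, Finset.sum_mul, ← Finset.sum_sub_distrib]
        exact Finset.sum_congr rfl fun v _ => by ring
    _ = ∑ c, ∑ v, w v * (f c (M v) (β v c) - mean (f c (M v))) := by
        refine Finset.sum_congr rfl fun c _ => ?_
        rw [Finset.sum_comm]
        exact Finset.sum_congr rfl fun v _ => pick c v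
    _ = ∑ v, w v * ∑ c, (f c (M v) (β v c) - mean (f c (M v))) := by
        rw [Finset.sum_comm]; simp only [Finset.mul_sum]

/-! ### Pointer jumping and round elimination. -/

/-- Inputs of pointer jumping on the complete `k`-ary tree of depth `D` whose levels are owned
alternately by the two players: `true` stands for the player who owns the root. -/
def TreeInput (k : ℕ) : Bool → ℕ → Type
  | _, 0 => Unit
  | true, D + 1 => Fin k × (Fin k → TreeInput k false D)
  | false, D + 1 => Fin k → TreeInput k true D

noncomputable instance TreeInput.fintype (k : ℕ) : ∀ (o : Bool) (D : ℕ), Fintype (TreeInput k o D)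
  | true, 0 => inferInstanceAs (Fintype Unit)
  | false, 0 => inferInstanceAs (Fintype Unit)
  | true, D + 1 =>
    haveI := TreeInput.fintype k false D
    inferInstanceAs (Fintype (Fin k × (Fin k → TreeInput k false D)))
  | false, D + 1 =>
    haveI := TreeInput.fintype k true D
    inferInstanceAs (Fintype (Fin k → TreeInput k true D))

instance TreeInput.nonempty (k : ℕ) [NeZero k] : ∀ (o : Bool) (D : ℕ), Nonempty (TreeInput k o D)
  | true, 0 => inferInstanceAs (Nonempty Unit)
  | false, 0 => inferInstanceAs (Nonempty Unit)
  | true, D + 1 =>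
    haveI := TreeInput.nonempty k false D
    inferInstanceAs (Nonempty (Fin k × (Fin k → TreeInput k false D)))
  | false, D + 1 =>
    haveI := TreeInput.nonempty k true D
    inferInstanceAs (Nonempty (Fin k → TreeInput k true D))

/-- The position, from left to right, of the leaf that the pointers lead to. -/
def treeLeaf (k : ℕ) : ∀ D : ℕ, TreeInput k true D → TreeInput k false D → ℕ
  | 0, _, _ => 0
  | D + 1, a, b => (a.1 : ℕ) * k ^ D + treeLeaf k D (b a.1) (a.2 a.1)

lemma treeLeaf_lt (k : ℕ) : ∀ (D : ℕ) (a : TreeInput k true D) (b : TreeInput k false D),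
    treeLeaf k D a b < k ^ D
  | 0, _, _ => by simp [treeLeaf]
  | D + 1, a, b => by
    have h := treeLeaf_lt k D (b a.1) (a.2 a.1)
    have h2 : ((a.1 : ℕ) + 1) * k ^ D ≤ k * k ^ D := Nat.mul_le_mul_right _ a.1.2
    rw [treeLeaf, pow_succ']
    linarith

/-- The function `g` of the inputs of two players is computed by `R` messages with values in `T`,
sent alternately, the first one by the player with inputs in `V`. -/
def AlternatingComputable (T : Type*) {Z : Type*} :
    ∀ (_ : ℕ) {U V : Type} (_ : U → V → Z), Prop
  | 0, _, _, g => ∃ z, ∀ u v, g u v = z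
  | R + 1, U, V, g => ∃ (M : V → T) (h : T → V → U → Z),
      (∀ m, AlternatingComputable T R (h m)) ∧ ∀ u v, g u v = h (M v) v u

/-- Serves to subtract the offset of a subtree from the answer, and to turn a crossing index into a
leaf position. -/
lemma AlternatingComputable.comp {T Z Z' : Type*} (φ : Z → Z') :
    ∀ {R : ℕ} {U V : Type} {g : U → V → Z}, AlternatingComputable T R g →
      AlternatingComputable T R (fun u v => φ (g u v))
  | 0, _, _, _, ⟨z, hz⟩ => ⟨φ z, fun u v => congrArg φ (hz u v)⟩
  | _ + 1, _, _, _, ⟨M, h, hh, hg⟩ =>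
    ⟨M, fun m v u => φ (h m v u), fun m => (hh m).comp φ, fun u v => congrArg φ (hg u v)⟩

/-- Under the uniform law the pointer is independent of the subtrees and takes each value with
probability 1/`k`. -/
lemma Dominated.root_pointer {U X : Type*} [Fintype U] [Fintype X] [Nonempty X] {k : ℕ} {a : ℝ}
    {w : U → ℝ} {α : U → Fin k × (Fin k → X)} (h : Dominated a w α) (c : Fin k) :
    Dominated (a * (k : ℝ)⁻¹) (fun u => if (α u).1 = c then w u else 0)
      (fun u => (α u).2 c) := by
  intro f hf
  have := h (fun q => if q.1 = c then f (q.2 c) else 0) (fun q => by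
    split_ifs; exacts [hf _, le_rfl])
  rw [mean_prod_fst_eq c (fun b : Fin k → X => f (b c)), mean_pi_apply, ← mul_assoc] at this
  refine le_trans (le_of_eq (Finset.sum_congr rfl fun u _ => ?_)) this
  by_cases hu : (α u).1 = c <;> simp [hu]

lemma sum_sum_eq_ite {U V : Type*} [Fintype U] [Fintype V] {I T : Type*} [Fintype I] [Fintype T]
    [DecidableEq I] [DecidableEq T] (p : U → I) (M : V → T) (wU : U → ℝ) (wV : V → ℝ)
    (F : U → V → ℝ) :
    ∑ u, ∑ v, wU u * wV v * F u v
      = ∑ c, ∑ m, ∑ u, ∑ v, (if p u = c then wU u else 0) * (if M v = m then wV v else 0)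
          * F u v := by
  have h1 : ∀ u v, wU u * wV v * F u v = ∑ c, ∑ m, (if p u = c then wU u else 0)
      * (if M v = m then wV v else 0) * F u v := by
    intro u v
    simp
  simp only [h1]
  calc ∑ u, ∑ v, ∑ c, ∑ m, (if p u = c then wU u else 0) * (if M v = m then wV v else 0) * F u v
      = ∑ u, ∑ c, ∑ m, ∑ v, (if p u = c then wU u else 0) * (if M v = m then wV v else 0)
          * F u v := by
        refine Finset.sum_congr rfl fun u _ => ?_
        rw [Finset.sum_comm]
        exact Finset.sum_congr rfl fun c _ => Finset.sum_comm
    _ = _ := by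
        rw [Finset.sum_comm]
        exact Finset.sum_congr rfl fun c _ => Finset.sum_comm

/-- On random instances of the problem of computing `leaf`, `R` messages succeed with probability
at most `q`. -/
def SuccessBound (T : Type*) (R : ℕ) {X Y : Type} [Fintype X] [Fintype Y] (leaf : X → Y → ℕ)
    (q : ℝ) : Prop :=
  ∀ (U V : Type) [Fintype U] [Fintype V] (g : U → V → ℕ), AlternatingComputable T R g →
    ∀ (wU : U → ℝ) (wV : V → ℝ), (∀ u, 0 ≤ wU u) → (∀ v, 0 ≤ wV v) →
    ∀ a b : ℝ, 0 ≤ a → 0 ≤ b → ∀ (α : U → X) (β : V → Y), Dominated a wU α → Dominated b wV β →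
    ∑ u, ∑ v, wU u * wV v * (if g u v = leaf (α u) (β v) then 1 else 0) ≤ a * b * q

/-- The leaf of a tree of which every child of the root has `n` leaves. -/
def succLeaf {X Y : Type} (k n : ℕ) (leaf : Y → X → ℕ) (p : Fin k × (Fin k → X))
    (b : Fin k → Y) : ℕ :=
  (p.1 : ℕ) * n + leaf (b p.1) (p.2 p.1)

/-- A constant answer `z` can be right only if the root pointer is `z / n`. -/
lemma successBound_zero (T : Type*) {X Y : Type} [Fintype X] [Fintype Y] [Nonempty X] [Nonempty Y]
    {k n : ℕ} {leaf : Y → X → ℕ} (hleaf : ∀ y x, leaf y x < n) :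
    SuccessBound T 0 (succLeaf k n leaf) (k : ℝ)⁻¹ := by
  rintro U V _ _ g ⟨z, hz⟩ wU wV hwU hwV a b ha hb α β hα hβ
  have hU : ∀ c : Fin k, ∑ u, (if (α u).1 = c then wU u else 0) ≤ a * (k : ℝ)⁻¹ :=
    fun c => (hα.root_pointer c).sum_le
  have hz' : ∀ u v, g u v = succLeaf k n leaf (α u) (β v) → ((α u).1 : ℕ) = z / n := by
    intro u v h
    have hlt := hleaf (β v (α u).1) ((α u).2 (α u).1)
    rw [← hz u v, h, succLeaf, add_comm, Nat.add_mul_div_right _ _ (by omega),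
      Nat.div_eq_of_lt hlt, zero_add]
  have hU' : ∑ u, (if ((α u).1 : ℕ) = z / n then wU u else 0) ≤ a * (k : ℝ)⁻¹ := by
    by_cases hzk : z / n < k
    · simpa [Fin.ext_iff] using hU ⟨z / n, hzk⟩
    · have : ∀ u, ((α u).1 : ℕ) ≠ z / n := fun u => by have := (α u).1.2; omega
      simp only [this, if_false, Finset.sum_const_zero]
      positivity
  calc ∑ u, ∑ v, wU u * wV v * (if g u v = succLeaf k n leaf (α u) (β v) then 1 else 0)
      ≤ (∑ u, (if ((α u).1 : ℕ) = z / n then wU u else 0)) * ∑ v, wV v := by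
        rw [Finset.sum_mul_sum]
        refine Finset.sum_le_sum fun u _ => Finset.sum_le_sum fun v _ => ?_
        by_cases h : g u v = succLeaf k n leaf (α u) (β v)
        · rw [if_pos h, if_pos (hz' u v h), mul_one]
        · rw [if_neg h, mul_zero]
          split_ifs
          · exact mul_nonneg (hwU u) (hwV v)
          · simp
    _ ≤ (a * (k : ℝ)⁻¹) * b :=
        mul_le_mul hU' hβ.sum_le (Finset.sum_nonneg fun v _ => hwV v) (by positivity)
    _ = _ := by ring

/-- Round elimination. -/
lemma SuccessBound.succ {T : Type*} [Fintype T] [Nonempty T] {X Y : Type} [Fintype X] [Fintype Y]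
    [Nonempty X] [Nonempty Y] {k n R : ℕ} [NeZero k] {l q : ℝ} (hl0 : 0 < l) (hl1 : l ≤ 1)
    (hq0 : 0 ≤ q) {leaf : Y → X → ℕ} (hleaf : SuccessBound T R leaf q) :
    SuccessBound T (R + 1) (succLeaf k n leaf)
      (q + (Real.log (Fintype.card T) + k * l ^ 2 + 1) / (l * k)) := by
  classical
  rintro U V _ _ g ⟨M, h, hh, hg⟩ wU wV hwU hwV a b ha hb α β hα hβ
  obtain ⟨w', h1, h2, h3, h4⟩ := hβ.exists_trim hb hwV M hl0.le hl1
  have hk : (0 : ℝ) < k := by exact_mod_cast NeZero.pos k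
  set E : ℝ := Real.log (Fintype.card T) + k * l ^ 2 + 1
  let wU' : Fin k → U → ℝ := fun c u => if (α u).1 = c then wU u else 0
  let wV' : T → V → ℝ := fun m v => if M v = m then wV v else 0
  have hwU' : ∀ c u, 0 ≤ wU' c u := by
    intro c u; simp only [wU']; split_ifs; exacts [hwU u, le_rfl]
  have hsU : ∀ c, ∑ u, wU' c u ≤ a * (k : ℝ)⁻¹ := fun c => (hα.root_pointer c).sum_le
  have hsV : ∑ m, ∑ v, wV' m v ≤ b := by
    rw [Finset.sum_comm]
    simpa [wV'] using hβ.sum_le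
  have hsV0 : ∀ m, 0 ≤ ∑ v, wV' m v := fun m => Finset.sum_nonneg fun v _ => by
    simp only [wV']; split_ifs; exacts [hwV v, le_rfl]
  -- Success on subtree `c`. Truncated subtraction is harmless: a correct answer is at least `c *
  -- n`, and only an upper bound on success is needed.
  let χ : Fin k → T → U → V → ℝ := fun c m u v =>
    if h m v u - c * n = leaf (β v c) ((α u).2 c) then 1 else 0
  have hχ0 : ∀ c m u v, 0 ≤ χ c m u v := fun c m u v => by simp only [χ]; positivity
  have hχ1 : ∀ c m u v, χ c m u v ≤ 1 := fun c m u v => by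
    simp only [χ]; split_ifs <;> norm_num
  -- The roles are exchanged: the sender of the eliminated message owns the root of subtree `c`.
  have ih : ∀ c m, ∑ v, ∑ u, w' c m v * wU' c u * χ c m u v
      ≤ (∑ v, wV' m v) * (a * (k : ℝ)⁻¹) * q := fun c m =>
    hleaf _ _ _ ((hh m).comp (fun z => z - c * n))
      (w' c m) (wU' c) (h1 c m) (hwU' c) _ _ (hsV0 m) (by positivity)
      (fun v => β v c) (fun u => (α u).2 c) (h3 c m) (hα.root_pointer c)
  have step : ∀ c m, ∑ u, ∑ v, wU' c u * wV' m v *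
        (if g u v = succLeaf k n leaf (α u) (β v) then 1 else 0)
      ≤ (∑ v, wV' m v) * (a * (k : ℝ)⁻¹) * q
        + (a * (k : ℝ)⁻¹) * ∑ v, (wV' m v - w' c m v) := by
    intro c m
    have hd : ∀ v, 0 ≤ wV' m v - w' c m v := fun v => sub_nonneg.2 (h2 c m v)
    -- The trimmed weight is left to the induction hypothesis; on the removed weight success is
    -- conceded.
    have pt : ∀ u v, wU' c u * wV' m v *
          (if g u v = succLeaf k n leaf (α u) (β v) then 1 else 0)
        ≤ w' c m v * wU' c u * χ c m u v + wU' c u * (wV' m v - w' c m v) := by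
      intro u v
      by_cases hc : (α u).1 = c
      · by_cases hm : M v = m
        · have : (if g u v = succLeaf k n leaf (α u) (β v) then (1 : ℝ) else 0)
              ≤ χ c m u v := by
            by_cases e : g u v = succLeaf k n leaf (α u) (β v)
            · have : h m v u - c * n = leaf (β v c) ((α u).2 c) := by
                rw [← hm, ← hg, e, succLeaf, hc]
                simp
              simp only [χ, if_pos this, if_pos e, le_refl]
            · rw [if_neg e]; exact hχ0 c m u v
          have e1 := mul_le_mul_of_nonneg_left this
            (mul_nonneg (hwU' c u) ((h1 c m v).trans (h2 c m v)))
          have e2 : wU' c u * (wV' m v - w' c m v) * χ c m u v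
              ≤ wU' c u * (wV' m v - w' c m v) :=
            mul_le_of_le_one_right (mul_nonneg (hwU' c u) (hd v)) (hχ1 c m u v)
          refine e1.trans ?_
          have : (if M v = m then wV v else 0) = wV' m v := rfl
          rw [this]
          linarith
        · have e1 : wV' m v = 0 := if_neg hm
          have e2 := mul_nonneg (hwU' c u) (hd v)
          have e3 := mul_nonneg (mul_nonneg (h1 c m v) (hwU' c u)) (hχ0 c m u v)
          rw [e1] at e2 ⊢
          linarith
      · have e1 : wU' c u = 0 := if_neg hc
        simp [e1]
    calc _ ≤ ∑ u, ∑ v, (w' c m v * wU' c u * χ c m u v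
            + wU' c u * (wV' m v - w' c m v)) :=
          Finset.sum_le_sum fun u _ => Finset.sum_le_sum fun v _ => pt u v
      _ = (∑ v, ∑ u, w' c m v * wU' c u * χ c m u v)
            + (∑ u, wU' c u) * ∑ v, (wV' m v - w' c m v) := by
          simp only [Finset.sum_add_distrib]
          rw [Finset.sum_mul_sum, Finset.sum_comm]
      _ ≤ _ := add_le_add (ih c m)
          (mul_le_mul_of_nonneg_right (hsU c) (Finset.sum_nonneg fun v _ => hd v))
  have loss : ∑ c, ∑ m, ∑ v, (wV' m v - w' c m v) ≤ b * E / l := by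
    rw [le_div_iff₀ hl0, mul_comm]; exact h4
  rw [sum_sum_eq_ite (fun u => (α u).1) M]
  calc _ ≤ ∑ c, ∑ m, ((∑ v, wV' m v) * (a * (k : ℝ)⁻¹) * q
        + (a * (k : ℝ)⁻¹) * ∑ v, (wV' m v - w' c m v)) :=
        Finset.sum_le_sum fun c _ => Finset.sum_le_sum fun m _ => step c m
    _ = (k * ((a * (k : ℝ)⁻¹) * q)) * (∑ m, ∑ v, wV' m v)
        + (a * (k : ℝ)⁻¹) * ∑ c, ∑ m, ∑ v, (wV' m v - w' c m v) := by
        simp only [Finset.sum_add_distrib, ← Finset.mul_sum, ← Finset.sum_mul]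
        simp
        ring
    _ ≤ (k * ((a * (k : ℝ)⁻¹) * q)) * b + (a * (k : ℝ)⁻¹) * (b * E / l) := by
        gcongr
    _ = _ := by
        field_simp

/-- Each message uses up one level, and one more level defeats the constant answer. -/
lemma successBound_treeLeaf {T : Type*} [Fintype T] [Nonempty T] {k : ℕ} [NeZero k]
    {l : ℝ} (hl0 : 0 < l) (hl1 : l ≤ 1) (R : ℕ) :
    SuccessBound T R (treeLeaf k (R + 1))
      ((k : ℝ)⁻¹ + R * ((Real.log (Fintype.card T) + k * l ^ 2 + 1) / (l * k))) := by
  have hE : 0 ≤ (Real.log (Fintype.card T) + k * l ^ 2 + 1) / (l * k) := by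
    have hT : (1 : ℝ) ≤ Fintype.card T := by exact_mod_cast Fintype.card_pos
    have := Real.log_nonneg hT
    positivity
  induction R with
  | zero =>
    have h : SuccessBound T 0 (succLeaf k (k ^ 0) (treeLeaf k 0)) (k : ℝ)⁻¹ :=
      successBound_zero T (treeLeaf_lt k 0)
    simp only [Nat.cast_zero, zero_mul, add_zero]
    exact h
  | succ R ih =>
    have h := SuccessBound.succ (k := k) (n := k ^ (R + 1)) hl0 hl1 (by positivity) ih
    rw [add_assoc, ← add_one_mul] at h
    push_cast
    exact h

/-! ### Staircases: pointer jumping inside monotone crossing. -/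

/-- The staircase function that encodes an input of pointer jumping. -/
def treePath (k : ℕ) : ∀ (o : Bool) (D : ℕ), TreeInput k o D → ℕ → ℕ
  | _, 0, _, j => if j = 0 then 0 else 1
  | true, D + 1, a, j =>
      if j < a.1 * k ^ D then 0
      else if j < (a.1 + 1) * k ^ D then
        (k - 1 - a.1) * k ^ D + treePath k false D (a.2 a.1) (j - a.1 * k ^ D)
      else k ^ (D + 1)
  | false, D + 1, b, j =>
      if h : j / k ^ D < k then
        (j / k ^ D) * k ^ D + treePath k true D (b ⟨j / k ^ D, h⟩) (j % k ^ D)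
      else k ^ (D + 1)

lemma treePath_le (k : ℕ) : ∀ (o : Bool) (D : ℕ) (a : TreeInput k o D) (j : ℕ),
    treePath k o D a j ≤ k ^ D
  | o, 0, a, j => by cases o <;> (simp only [treePath]; split_ifs <;> simp)
  | true, D + 1, a, j => by
    have ih := treePath_le k false D (a.2 a.1) (j - a.1 * k ^ D)
    simp only [treePath]
    split_ifs
    · exact Nat.zero_le _
    · have h := a.1.2
      have : (k - 1 - (a.1 : ℕ) + 1) * k ^ D ≤ k * k ^ D := Nat.mul_le_mul_right _ (by omega)
      rw [pow_succ']
      linarith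
    · exact le_rfl
  | false, D + 1, b, j => by
    simp only [treePath]
    split_ifs with h
    · have ih := treePath_le k true D (b ⟨j / k ^ D, h⟩) (j % k ^ D)
      have : (j / k ^ D + 1) * k ^ D ≤ k * k ^ D := Nat.mul_le_mul_right _ h
      rw [pow_succ']
      linarith
    · exact le_rfl

lemma treePath_mono (k : ℕ) : ∀ (o : Bool) (D : ℕ) (a : TreeInput k o D),
    Monotone (treePath k o D a)
  | o, 0, a => by
    intro i j hij
    cases o <;> (simp only [treePath]; split_ifs <;> omega)
  | true, D + 1, a => by
    intro i j hij
    have ih := treePath_mono k false D (a.2 a.1)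
    have hle := treePath_le k true (D + 1) a i
    simp only [treePath] at hle ⊢
    split_ifs at hle ⊢ with h1 h2 h3 h4 h5 h6
    all_goals first | exact Nat.zero_le _ | omega | skip
    · exact Nat.add_le_add_left (ih (Nat.sub_le_sub_right hij _)) _
  | false, D + 1, b => by
    intro i j hij
    have hle := treePath_le k false (D + 1) b i
    have hd : i / k ^ D ≤ j / k ^ D := Nat.div_le_div_right hij
    simp only [treePath] at hle ⊢
    by_cases hj : j / k ^ D < k
    · have hi : i / k ^ D < k := hd.trans_lt hj
      rw [dif_pos hj, dif_pos hi]
      rcases hd.eq_or_lt with e | e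
      · have e2 : i % k ^ D ≤ j % k ^ D := by
          have := Nat.div_add_mod i (k ^ D)
          have := Nat.div_add_mod j (k ^ D)
          rw [e] at *
          omega
        simp only [e]
        exact Nat.add_le_add_left (treePath_mono k true D _ e2) _
      · have ih := treePath_le k true D (b ⟨i / k ^ D, hi⟩) (i % k ^ D)
        have : (i / k ^ D + 1) * k ^ D ≤ (j / k ^ D) * k ^ D := Nat.mul_le_mul_right _ e
        rw [add_one_mul] at this
        omega
    · rw [dif_neg hj]
      exact hle

/-- Let n be the number of leaves below a child and p the root pointer. Before block p the owner's
staircase is 0 and the other is below its top. After it the owner's is at the top and the other is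
positive. Inside it the base heights (k - 1 - p)n and pn add up to (k - 1)n, so the comparison is
that of the subtree. -/
lemma treePath_cross (k : ℕ) : ∀ (D : ℕ) (a : TreeInput k true D) (b : TreeInput k false D)
    (j : ℕ), (j ≤ treeLeaf k D a b → treePath k true D a j + treePath k false D b j < k ^ D) ∧
      (treeLeaf k D a b < j → k ^ D < treePath k true D a j + treePath k false D b j)
  | 0, a, b, j => by
    simp only [treePath, treeLeaf]
    constructor <;> intro h
    · have : j = 0 := by omega
      simp [this]
    · have : j ≠ 0 := by omega
      simp [this]
  | D + 1, a, b, j => by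
    have ih := treePath_cross k D (b a.1) (a.2 a.1)
    have hlt := treeLeaf_lt k D (b a.1) (a.2 a.1)
    have hp := a.1.2
    set n := k ^ D with hn
    have hn0 : 0 < n := by omega
    have hkn : k ^ (D + 1) = k * n := pow_succ' k D
    simp only [treePath, treeLeaf, ← hn]
    set p : ℕ := (a.1 : ℕ) with hpdef
    have hN : (k - 1 - p) * n + p * n + n = k * n := by
      rw [← add_mul, ← add_one_mul]; congr 1; omega
    rw [hkn]
    by_cases h1 : j < p * n
    · have hd : j / n < p := Nat.div_lt_of_lt_mul (by rwa [mul_comm])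
      have hk : j / n < k := by omega
      have hle := treePath_le k true D (b ⟨j / n, hk⟩) (j % n)
      have : (j / n + 1) * n ≤ p * n := Nat.mul_le_mul_right _ hd
      rw [add_one_mul] at this
      rw [if_pos h1, dif_pos hk]
      constructor <;> intro h <;> omega
    · rw [if_neg h1]
      by_cases h2 : j < (p + 1) * n
      · rw [if_pos h2]
        rw [add_one_mul] at h2
        have hd : j / n = p := by
          rw [Nat.div_eq_iff hn0]
          constructor
          · omega
          · omega
        have hk : j / n < k := by omega
        have hm : j % n = j - p * n := by
          have := Nat.div_add_mod j n
          rw [hd, mul_comm] at this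
          omega
        have hb : b ⟨j / n, hk⟩ = b a.1 := by congr 1; exact Fin.ext hd
        rw [dif_pos hk, hb, hm, hd]
        obtain ⟨i1, i2⟩ := ih (j - p * n)
        constructor <;> intro h
        · have := i1 (by omega); omega
        · have := i2 (by omega); omega
      · rw [if_neg h2]
        rw [add_one_mul] at h2
        constructor <;> intro h
        · omega
        · by_cases hk : j / n < k
          · rw [dif_pos hk]
            have : 1 ≤ j / n := (Nat.one_le_div_iff hn0).2 (by omega)
            have := Nat.mul_le_mul_right n this
            omega
          · rw [dif_neg hk]
            have : 1 * n ≤ k * n := Nat.mul_le_mul_right _ (by omega)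
            omega

/-- The input of Alice that an input of the owner of the root is mapped to. -/
def treeAlice {k D m : ℕ} (hm : k ^ D < m) (a : TreeInput k true D) : MonCrossingAlice m :=
  ⟨fun i => if (i : ℕ) = 0 then 0 else if (i : ℕ) = m then m else treePath k true D a (i - 1), by
    simp, by
    intro i j hij
    have hij' : (i : ℕ) ≤ j := hij
    have hj := j.is_le
    have h1 := treePath_le k true D a (i - 1)
    have h2 := treePath_mono k true D a (Nat.sub_le_sub_right hij' 1)
    dsimp only
    split_ifs <;> omega, by
    simp only [Fin.val_last]
    split_ifs <;> omega⟩

/-- The input of Bob that an input of the other player is mapped to. -/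
def treeBob {k D m : ℕ} (hm : k ^ D < m) (b : TreeInput k false D) : MonCrossingBob m :=
  ⟨fun i => if (i : ℕ) = 0 then m else if (i : ℕ) = m then 0 else
      k ^ D - treePath k false D b (i - 1), by
    simp, by
    intro i j hij
    have hij' : (i : ℕ) ≤ j := hij
    have hj := j.is_le
    have h2 := treePath_mono k false D b (Nat.sub_le_sub_right hij' 1)
    dsimp only
    split_ifs <;> omega, by
    simp only [Fin.val_last]
    split_ifs <;> omega⟩

/-- Index `i` carries the staircases at `i - 1`, and `j` stands for index `j + 1`, hence the shift.
The room left by `k ^ D < m` keeps the prescribed end values from creating another crossing. -/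
lemma MonCrossing.eq_treeLeaf {k D m : ℕ} (hm : k ^ D < m) (a : TreeInput k true D)
    (b : TreeInput k false D) {j : Fin m}
    (h : MonCrossing m (treeAlice hm a) (treeBob hm b) j) : (j : ℕ) - 1 = treeLeaf k D a b := by
  obtain ⟨h1, h2⟩ := h
  have hj := j.2
  have hlt := treeLeaf_lt k D a b
  have c1 := (treePath_cross k D a b (j - 1)).2
  have c2 := (treePath_cross k D a b j).1
  have l1 := treePath_le k false D b (j - 1)
  have l2 := treePath_le k false D b j
  simp only [treeAlice, treeBob, Fin.val_castSucc, Fin.val_succ, Nat.add_sub_cancel,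
    Nat.add_eq_zero_iff, one_ne_zero, and_false, if_false] at h1 h2
  split_ifs at h1 h2 <;> omega

/-- Alice's input that jumps from `0` to `m` at the index `j + 1`. -/
def jumpAlice {m : ℕ} (j : Fin m) : MonCrossingAlice m :=
  ⟨fun i => if (i : ℕ) ≤ j then 0 else m, by simp, by
    intro i i' hi
    have : (i : ℕ) ≤ i' := hi
    dsimp only
    split_ifs <;> omega, by simp⟩

/-- Bob's input that jumps from `m` to `0` at the index `j + 1`. -/
def jumpBob {m : ℕ} (j : Fin m) : MonCrossingBob m :=
  ⟨fun i => if (i : ℕ) ≤ j then m else 0, by simp, by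
    intro i i' hi
    have : (i : ℕ) ≤ i' := hi
    dsimp only
    split_ifs <;> omega, by simp⟩

lemma MonCrossing.eq_of_jump {m : ℕ} {i j : Fin m}
    (h : MonCrossing m (jumpAlice j) (jumpBob j) i) : i = j := by
  obtain ⟨h1, h2⟩ := h
  have hi := i.2
  have hj := j.2
  simp only [jumpAlice, jumpBob, Fin.val_castSucc, Fin.val_succ] at h1 h2
  ext
  split_ifs at h1 h2 <;> omega

/-! ### Messages and protocols as alternating computations. -/

/-- The positions of a message, with `none` beyond its end. -/
def Message.toFun {t : ℕ} (w : Message t) (i : Fin t) : Option Bool := w.1[(i : ℕ)]?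

lemma Message.toFun_injective (t : ℕ) : Function.Injective (Message.toFun (t := t)) := by
  intro v w h
  refine Subtype.ext (List.ext_getElem? fun i => ?_)
  by_cases hi : i < t
  · exact congrFun h ⟨i, hi⟩
  · rw [List.getElem?_eq_none (by have := v.2; omega),
      List.getElem?_eq_none (by have := w.2; omega)]

noncomputable instance Message.fintype (t : ℕ) : Fintype (Message t) :=
  Fintype.ofInjective _ (Message.toFun_injective t)

instance Message.nonempty (t : ℕ) : Nonempty (Message t) := ⟨⟨[], by simp⟩⟩

/-- Padding a message to length `t` with a third symbol gives at most `3 ^ t` messages. -/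
lemma Message.log_card_le (t : ℕ) : Real.log (Fintype.card (Message t)) ≤ 2 * t := by
  have h : Fintype.card (Message t) ≤ 3 ^ t := by
    simpa using Fintype.card_le_of_injective _ (Message.toFun_injective t)
  have h0 : (0 : ℝ) < Fintype.card (Message t) := by exact_mod_cast Fintype.card_pos
  calc Real.log (Fintype.card (Message t)) ≤ Real.log ((3 : ℝ) ^ t) :=
        Real.log_le_log h0 (by exact_mod_cast h)
    _ = t * Real.log 3 := Real.log_pow _ _
    _ ≤ t * (3 - 1) := by gcongr; exact Real.log_le_sub_one_of_pos (by norm_num)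
    _ = 2 * t := by ring

namespace Protocol

variable {X Y Z : Type*} {t r : ℕ}

/-- The transcript `n` rounds after the transcript `τ`. -/
def runFrom (P : Protocol X Y Z t r) (x : X) (y : Y) : ℕ → Transcript t → Transcript t
  | 0, τ => τ
  | n + 1, τ => runFrom P x y n (τ ++ [(P.alice x τ, P.bob y τ)])

lemma runFrom_succ (P : Protocol X Y Z t r) (x : X) (y : Y) (n : ℕ) (τ : Transcript t) :
    P.runFrom x y (n + 1) τ = P.runFrom x y n τ ++
      [(P.alice x (P.runFrom x y n τ), P.bob y (P.runFrom x y n τ))] := by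
  induction n generalizing τ with
  | zero => rfl
  | succ n ih => rw [runFrom, ih, runFrom]

lemma transcript_eq_runFrom (P : Protocol X Y Z t r) (x : X) (y : Y) (n : ℕ) :
    P.transcript x y n = P.runFrom x y n [] := by
  induction n with
  | zero => rfl
  | succ n ih => rw [transcript, runFrom_succ, ih]

/-- Simultaneous messages are put in order, Bob's first since Alice will own the root. This only
gives Alice more knowledge. Peeling rounds off the front matches the recursion of
`AlternatingComputable`. -/
lemma alternatingComputable_runFrom (P : Protocol X Y Z t r) {U V : Type} (α : U → X) (β : V → Y)
    (n : ℕ) (τ : Transcript t) :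
    AlternatingComputable (Message t) (2 * n)
      (fun u v => P.out (P.runFrom (α u) (β v) n τ)) := by
  induction n generalizing τ with
  | zero => exact ⟨P.out τ, fun _ _ => rfl⟩
  | succ n ih =>
    exact ⟨fun v => P.bob (β v) τ,
      fun m v u => P.out (P.runFrom (α u) (β v) n (τ ++ [(P.alice (α u) τ, m)])),
      fun m => ⟨fun u => P.alice (α u) τ,
        fun m' u v => P.out (P.runFrom (α u) (β v) n (τ ++ [(m', m)])),
        fun m' => ih _, fun _ _ => rfl⟩, fun _ _ => rfl⟩

lemma alternatingComputable_output (P : Protocol X Y Z t r) {U V : Type} (α : U → X) (β : V → Y) :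
    AlternatingComputable (Message t) (2 * r) (fun u v => P.output (α u) (β v)) := by
  simp only [output, transcript_eq_runFrom]
  exact P.alternatingComputable_runFrom α β r []

end Protocol

/-! ### Hard inputs, derandomization and the lower bound. -/

lemma dominated_one_id (B : Type*) [Fintype B] [Nonempty B] :
    Dominated (Fintype.card B : ℝ) (fun _ : B => 1) (fun b => b) := by
  intro h _
  have : (Fintype.card B : ℝ) ≠ 0 := by exact_mod_cast Fintype.card_ne_zero
  simp [mean, this]

open Classical in
/-- A protocol with few rounds fails on most of the inputs that come from pointer jumping. -/
lemma Protocol.sum_monCrossing_le {m t r : ℕ} (ht : 1 ≤ t) (hm : (t ^ 3) ^ (2 * r + 1) < m)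
    (P : Protocol (MonCrossingAlice m) (MonCrossingBob m) (Fin m) t r) :
    (∑ p : TreeInput (t ^ 3) true (2 * r + 1) × TreeInput (t ^ 3) false (2 * r + 1),
        if MonCrossing m (treeAlice hm p.1) (treeBob hm p.2)
          (P.output (treeAlice hm p.1) (treeBob hm p.2)) then (1 : ℝ) else 0)
      ≤ Fintype.card (TreeInput (t ^ 3) true (2 * r + 1) × TreeInput (t ^ 3) false (2 * r + 1))
        * ((8 * r + 1) / t) := by
  have ht' : (1 : ℝ) ≤ t := by exact_mod_cast ht
  have ht0 : (0 : ℝ) < t := by linarith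
  have : NeZero (t ^ 3) := ⟨by positivity⟩
  -- With `l` = 1/`t` and `k = t ^ 3`, the numerator of the loss per message is at most 2`t` + `t` +
  -- 1 and the denominator is `t`², so each message costs at most 4/`t`.
  have main := successBound_treeLeaf (T := Message t) (k := t ^ 3) (l := (t : ℝ)⁻¹)
    (by positivity) (inv_le_one_of_one_le₀ ht') (2 * r) _ _ _
    ((P.alternatingComputable_output (treeAlice hm) (treeBob hm)).comp
      (fun j : Fin m => (j : ℕ) - 1))
    (fun _ => 1) (fun _ => 1) (fun _ => zero_le_one) (fun _ => zero_le_one) _ _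
    (Nat.cast_nonneg _) (Nat.cast_nonneg _) (fun a => a) (fun b => b)
    (dominated_one_id _) (dominated_one_id _)
  rw [Fintype.sum_prod_type]
  have hq : (((t ^ 3 : ℕ) : ℝ)⁻¹ + (2 * r : ℕ) * ((Real.log (Fintype.card (Message t))
      + (t ^ 3 : ℕ) * (t : ℝ)⁻¹ ^ 2 + 1) / ((t : ℝ)⁻¹ * (t ^ 3 : ℕ)))) ≤ (8 * r + 1) / t := by
    push_cast
    have e1 : (t : ℝ) ^ 3 * (t : ℝ)⁻¹ ^ 2 = t := by field_simp
    have e2 : (t : ℝ)⁻¹ * (t : ℝ) ^ 3 = t ^ 2 := by field_simp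
    rw [e1, e2]
    have e3 : (Real.log (Fintype.card (Message t)) + t + 1) / (t : ℝ) ^ 2 ≤ 4 / t := by
      rw [div_le_div_iff₀ (by positivity) ht0]
      have := Message.log_card_le t
      nlinarith
    have e4 : ((t : ℝ) ^ 3)⁻¹ ≤ (t : ℝ)⁻¹ :=
      inv_anti₀ ht0 (le_self_pow₀ ht' (by norm_num))
    calc _ ≤ (t : ℝ)⁻¹ + 2 * r * (4 / t) := by gcongr
      _ = _ := by field_simp; ring
  calc _ ≤ _ := Finset.sum_le_sum fun a _ => Finset.sum_le_sum fun b _ => ?_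
    _ ≤ _ := main
    _ ≤ _ := mul_le_mul_of_nonneg_left hq (by positivity)
    _ = _ := by rw [Fintype.card_prod, Nat.cast_mul]
  by_cases h : MonCrossing m (treeAlice hm a) (treeBob hm b)
      (P.output (treeAlice hm a) (treeBob hm b))
  · rw [if_pos h, if_pos h.eq_treeLeaf]; norm_num
  · rw [if_neg h]; positivity

/-- If every event of a finite family has probability at most `ε`, then some outcome lies in at
most a fraction `ε` of them. -/
lemma exists_sum_mem_le {Ω ι : Type*} [MeasurableSpace Ω] (ν : Measure Ω) [IsProbabilityMeasure ν]
    [Fintype ι] (bad : ι → Set Ω) {ε : ℝ} (hε : 0 ≤ ε) (h : ∀ i, ν (bad i) ≤ ENNReal.ofReal ε) :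
    ∃ ω, ∑ i, (bad i).indicator (1 : Ω → ℝ) ω ≤ Fintype.card ι * ε := by
  -- The events may be non-measurable; their measurable hulls have the same measure.
  let f : Ω → ENNReal := fun ω => ∑ i, (toMeasurable ν (bad i)).indicator 1 ω
  have hf : ∀ i, Measurable ((toMeasurable ν (bad i)).indicator (1 : Ω → ENNReal)) :=
    fun i => measurable_one.indicator (measurableSet_toMeasurable _ _)
  have hf' : Measurable f := Finset.measurable_fun_sum _ fun i _ => hf i
  obtain ⟨ω, hω⟩ := exists_le_lintegral (μ := ν) hf'.aemeasurable
  refine ⟨ω, ?_⟩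
  have h1 : ∫⁻ ω, f ω ∂ν ≤ ENNReal.ofReal (Fintype.card ι * ε) := by
    simp only [f]
    rw [lintegral_finsetSum _ fun i _ => hf i]
    calc _ ≤ ∑ _i : ι, ENNReal.ofReal ε := Finset.sum_le_sum fun i _ => by
          rw [lintegral_indicator_one (measurableSet_toMeasurable _ _), measure_toMeasurable]
          exact h i
      _ = _ := by
          rw [ENNReal.ofReal_mul (Nat.cast_nonneg _)]; simp
  have h2 : ENNReal.ofReal (∑ i, (bad i).indicator (1 : Ω → ℝ) ω) ≤ f ω := by
    rw [ENNReal.ofReal_sum_of_nonneg fun i _ => Set.indicator_nonneg (by simp) ω]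
    refine Finset.sum_le_sum fun i _ => ?_
    by_cases hi : ω ∈ bad i
    · rw [Set.indicator_of_mem hi, Set.indicator_of_mem (subset_toMeasurable ν _ hi)]; simp
    · simp [hi]
  exact (ENNReal.ofReal_le_ofReal_iff (by positivity)).1 (h2.trans (hω.trans h1))

open Classical in
/-- A randomized protocol can be derandomized on a finite family of inputs. -/
lemma RandomizedProtocol.SolvesWithError.exists_fixCoins {R A B X Y Z ι : Type*} {t r : ℕ}
    [MeasurableSpace R] [MeasurableSpace A] [MeasurableSpace B]
    {μ : Measure R} {α : Measure A} {β : Measure B}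
    [IsProbabilityMeasure μ] [IsProbabilityMeasure α] [IsProbabilityMeasure β]
    {P : RandomizedProtocol R A B X Y Z t r} {S : X → Y → Z → Prop} {ε : ℝ} (hε : 0 ≤ ε)
    (h : P.SolvesWithError μ α β S ε) [Fintype ι] (x : ι → X) (y : ι → Y) :
    ∃ Q : Protocol X Y Z t r, (1 - ε) * Fintype.card ι
      ≤ ∑ i, if S (x i) (y i) (Q.output (x i) (y i)) then (1 : ℝ) else 0 := by
  obtain ⟨ω, hω⟩ := exists_sum_mem_le (μ.prod (α.prod β)) (fun i : ι =>
    {ω | ¬ S (x i) (y i) ((P.fixCoins ω.1 ω.2.1 ω.2.2).output (x i) (y i))}) hε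
    (fun i => h (x i) (y i))
  refine ⟨P.fixCoins ω.1 ω.2.1 ω.2.2, ?_⟩
  have key : ∀ i, (if S (x i) (y i) ((P.fixCoins ω.1 ω.2.1 ω.2.2).output (x i) (y i))
      then (1 : ℝ) else 0) = 1 - Set.indicator {ω | ¬ S (x i) (y i)
        ((P.fixCoins ω.1 ω.2.1 ω.2.2).output (x i) (y i))} 1 ω := by
    intro i
    by_cases hS : S (x i) (y i) ((P.fixCoins ω.1 ω.2.1 ω.2.2).output (x i) (y i)) <;> simp [hS]
  simp only [key, Finset.sum_sub_distrib, Finset.sum_const, Finset.card_univ, nsmul_eq_mul,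
    mul_one]
  linarith

open Classical in
-- Without communication the output is one fixed index, while the jump inputs have pairwise distinct
-- unique solutions.
lemma Protocol.sum_monCrossing_jump_le {m t : ℕ}
    (P : Protocol (MonCrossingAlice m) (MonCrossingBob m) (Fin m) t 0) :
    (∑ j : Fin m, if MonCrossing m (jumpAlice j) (jumpBob j) (P.output (jumpAlice j) (jumpBob j))
      then (1 : ℝ) else 0) ≤ 1 := by
  calc _ ≤ ∑ j : Fin m, if P.out [] = j then (1 : ℝ) else 0 := by
        refine Finset.sum_le_sum fun j _ => ?_
        by_cases h : MonCrossing m (jumpAlice j) (jumpBob j) (P.out [])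
        · rw [if_pos h.eq_of_jump]; split_ifs <;> norm_num
        · rw [if_neg (show ¬ MonCrossing m (jumpAlice j) (jumpBob j)
            (P.output (jumpAlice j) (jumpBob j)) from h)]
          positivity
    _ = 1 := by simp

/-- The lower bound for randomized protocols, with an explicit constant. -/
theorem RandomizedProtocol.SolvesWithError.rounds_ge {m t r : ℕ} {ε : ℝ} (hε0 : 0 ≤ ε)
    (ht : 2 ≤ t) (hmt : Real.logb 2 m ≤ t) (htm : t ≤ m) (hm : 1 < (1 - ε) * m)
    {R A B : Type*} [MeasurableSpace R] [MeasurableSpace A] [MeasurableSpace B]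
    {μ : Measure R} {α : Measure A} {β : Measure B}
    [IsProbabilityMeasure μ] [IsProbabilityMeasure α] [IsProbabilityMeasure β]
    {P : RandomizedProtocol R A B (MonCrossingAlice m) (MonCrossingBob m) (Fin m) t r}
    (hP : P.SolvesWithError μ α β (MonCrossing m) ε) :
    (1 - ε) / 10 * (Real.logb 2 m / Real.logb 2 t) ≤ r := by
  by_contra! hr
  have ht' : (2 : ℝ) ≤ t := by exact_mod_cast ht
  have hm0 : (0 : ℝ) < m := by exact_mod_cast (by omega : 0 < m)
  have hlt : 1 ≤ Real.logb 2 t := by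
    rw [Real.le_logb_iff_rpow_le (by norm_num) (by linarith)]; simpa using ht'
  have hlm : 0 ≤ Real.logb 2 m := Real.logb_nonneg (by norm_num) (by
    have : (t : ℝ) ≤ m := by exact_mod_cast htm
    linarith)
  have hε1 : 0 < 1 - ε := by
    by_contra! h
    nlinarith
  -- For `r = 0` the tree bound 1/`t` need not be below `1 - ε`; the jump inputs give success at
  -- most 1/`m` instead.
  rcases Nat.eq_zero_or_pos r with rfl | hr0
  · obtain ⟨Q, hQ⟩ := hP.exists_fixCoins hε0 (jumpAlice (m := m)) jumpBob
    have := hQ.trans Q.sum_monCrossing_jump_le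
    rw [Fintype.card_fin] at this
    linarith
  · have hr1 : (1 : ℝ) ≤ r := by exact_mod_cast hr0
    rw [← mul_div_assoc, lt_div_iff₀ (by linarith)] at hr
    have hpow : (t ^ 3) ^ (2 * r + 1) < m := by
      have h1 : (9 * r : ℝ) * Real.logb 2 t < Real.logb 2 m := by nlinarith
      have h2 : Real.logb 2 ((t : ℝ) ^ (9 * r)) < Real.logb 2 m := by
        rw [Real.logb_pow]; push_cast; exact h1
      have h3 : t ^ (9 * r) < m := by
        have := (Real.logb_lt_logb_iff (by norm_num) (by positivity) hm0).1 h2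
        exact_mod_cast this
      rw [← pow_mul]
      -- 3(2`r` + 1) ≤ 9`r` because `r` ≥ 1.
      exact lt_of_le_of_lt (Nat.pow_le_pow_right (by omega) (by omega)) h3
    obtain ⟨Q, hQ⟩ := hP.exists_fixCoins hε0
      (fun p : TreeInput (t ^ 3) true (2 * r + 1) × TreeInput (t ^ 3) false (2 * r + 1) =>
        treeAlice hpow p.1) (fun p => treeBob hpow p.2)
    have h := hQ.trans (Q.sum_monCrossing_le (by omega) hpow)
    have : NeZero (t ^ 3) := ⟨by positivity⟩
    have hcard : (0 : ℝ) < Fintype.card (TreeInput (t ^ 3) true (2 * r + 1)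
        × TreeInput (t ^ 3) false (2 * r + 1)) := by exact_mod_cast Fintype.card_pos
    rw [mul_comm, mul_le_mul_iff_right₀ hcard, le_div_iff₀ (by linarith)] at h
    -- Now (1 - `ε`)`t` ≤ 8`r` + 1 ≤ 9`r`, whereas log `m` ≤ `t` and log `t` ≥ 1 give 10`r` < (1 -
    -- `ε`)`t`.
    nlinarith

/-- A deterministic protocol is a randomized one without coins. -/
def Protocol.toRandomized {X Y Z : Type*} {t r : ℕ} (P : Protocol X Y Z t r) :
    RandomizedProtocol Unit Unit Unit X Y Z t r where
  alice _ _ := P.alice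
  bob _ _ := P.bob
  out _ := P.out

lemma Protocol.Solves.toRandomized {X Y Z : Type*} {t r : ℕ} {P : Protocol X Y Z t r}
    {S : X → Y → Z → Prop} (h : P.Solves S) :
    P.toRandomized.SolvesWithError (Measure.dirac ()) (Measure.dirac ()) (Measure.dirac ()) S 0 := by
  intro x y
  have : ∀ ω : Unit × Unit × Unit,
      S x y ((P.toRandomized.fixCoins ω.1 ω.2.1 ω.2.2).output x y) := fun _ => h x y
  simp [this]
theorem mainTheorem1 :
    (∃ c : ℝ, 0 < c ∧ ∀ m t r : ℕ, 2 ≤ t → Real.logb 2 m ≤ t → t ≤ m →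
      ∀ P : Protocol (MonCrossingAlice m) (MonCrossingBob m) (Fin m) t r,
        P.Solves (MonCrossing m) →
        c * (Real.logb 2 m / Real.logb 2 t) ≤ r) ∧
    (∀ ε : ℝ, 0 ≤ ε → ε < 1 →
      ∃ c : ℝ, 0 < c ∧ ∀ m t r : ℕ, 2 ≤ t → Real.logb 2 m ≤ t → t ≤ m → 1 < (1 - ε) * m →
        ∀ (R A B : Type*) [MeasurableSpace R] [MeasurableSpace A] [MeasurableSpace B]
          (μ : Measure R) (α : Measure A) (β : Measure B)
          [IsProbabilityMeasure μ] [IsProbabilityMeasure α] [IsProbabilityMeasure β]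
          (P : RandomizedProtocol R A B
            (MonCrossingAlice m) (MonCrossingBob m) (Fin m) t r),
          P.SolvesWithError μ α β (MonCrossing m) ε →
          c * (Real.logb 2 m / Real.logb 2 t) ≤ r) := by
  refine ⟨⟨(1 - 0) / 10, by norm_num, fun m t r ht hmt htm P hP => ?_⟩,
    fun ε hε0 hε1 => ⟨(1 - ε) / 10, by linarith, ?_⟩⟩
  · refine hP.toRandomized.rounds_ge le_rfl ht hmt htm ?_
    have : (2 : ℝ) ≤ m := by exact_mod_cast ht.trans htm
    linarith
  · intro m t r ht hmt htm hm R A B _ _ _ μ α β _ _ _ P hP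
    exact hP.rounds_ge hε0 ht hmt htm hm
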